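/- Let $V$ be a finite set and let $X_v$ ($v\in V$) be random variables with finite state spaces $\mathfrak{X}_v$, each having at least two elements; put $\mathfrak{X}=\prod_{v}\mathfrak{X}_v$ and let $\Delta^\circ\subset\mathbb{R}^{\mathfrak{X}}$ be the set of strictly positive probability vectors on $\mathfrak{X}$. For a directed acyclic graph $\mathcal{G}$ on $V$, the Bayesian network model $\mathcal{M}(\mathcal{G})\subseteq\Delta^\circ$ consists of all $p\in\Delta^\circ$ that factorize as $p(x)=\prod_{v}\kappa_v(x_v\mid x_{\mathrm{pa}(v)})$ with conditional probability tables $\kappa_v$. The tangent cone $\mathrm{TC}_\theta(\mathcal{M})$ is the set of limits of sequences $\alpha_n(\theta_n-\theta)$ with $\alpha_n>0$, $\theta_n\in\mathcal{M}$, $\theta_n\to\theta$. Two models $\mathcal{M}_1,\mathcal{M}_2$ overlap at $\theta\in\mathcal{M}_1\cap\mathcal{M}_2$ if there is $h\in\mathrm{TC}_\theta(\mathcal{M}_1)\cap\mathrm{TC}_\theta(\mathcal{M}_2)$ with $h\notin\mathrm{TC}_\theta(\mathcal{M}_1\cap\mathcal{M}_2)$. A class of models is simultaneously convex near $\theta\in\Delta^\circ$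 if there are a neighbourhood $W$ of $\theta$ in $\Delta^\circ$ (possibly $W=\Delta^\circ$), an open set $\Theta\subseteq\mathbb{R}^{|\mathfrak{X}|-1}$ and a twice differentiable bijection $\psi:\Theta\to W$ with Jacobian of full column rank everywhere, such that, for every model $\mathcal{M}$ in the class, $\psi^{-1}(\mathcal{M})$ is convex in a neighbourhood of $\psi^{-1}(\theta)$. (1) Let $\mathcal{G}_1,\mathcal{G}_2$ be directed acyclic graphs on $V$ such that $i\to k\leftarrow j$ is an unshielded collider in $\mathcal{G}_1$ (that is, $i\neq j$ are not joined by an edge), while $i,k,j$ is an unshielded noncollider in $\mathcal{G}_2$ ($i,j$ are not joined, both are joined to $k$, and not both edges point to $k$). If $X_k$ is binary, then there is a point $\theta$ at which $\mathcal{M}(\mathcal{G}_1)$ and $\mathcal{M}(\mathcal{G}_2)$ overlap and near which they are not simultaneously convex. (2) Consequently, if $|V|\ge 3$ and at least one of the variables is binary, there is a point $\theta$ common to all Bayesian network models on $V$ near which the class of all these models is not simultaneously convex. Thus the convex parameterization of the candidate models on which lasso-type convex model selection methods rely does not exist for Bayesian networks. -/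

import Mathlib

open Filter Topology

/-! ### Directed acyclic graphs, colliders and noncolliders -/

/-- A directed graph (`G.Adj u v` is the edge `u → v`) without directed cycles. -/
def Digraph.IsDAG {V : Type*} (G : Digraph V) : Prop :=
  ∀ v, ¬ Relation.TransGen G.Adj v v

/-- `u` and `v` are joined by an edge, in one direction or the other. -/
def Digraph.Joined {V : Type*} (G : Digraph V) (u v : V) : Prop :=
  G.Adj u v ∨ G.Adj v u

/-- `i → k ← j` is an unshielded collider: `i` and `j` are distinct and not joined. -/
def Digraph.UnshieldedCollider {V : Type*} (G : Digraph V) (i k j : V) : Prop :=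
  i ≠ j ∧ ¬ G.Joined i j ∧ G.Adj i k ∧ G.Adj j k

/-- The path `i, k, j` is an unshielded noncollider: `i` and `j` are distinct and not joined, both
are joined to `k`, and the two edges do not both point to `k`. -/
def Digraph.UnshieldedNoncollider {V : Type*} (G : Digraph V) (i k j : V) : Prop :=
  i ≠ j ∧ ¬ G.Joined i j ∧ G.Joined i k ∧ G.Joined j k ∧ ¬ (G.Adj i k ∧ G.Adj j k)

/-! ### Discrete Bayesian network models -/

/-- Strictly positive probability vectors on a finite set (the open probability simplex). -/
def openSimplex (S : Type*) [Fintype S] : Set (S → ℝ) :=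
  {p | (∀ x, 0 < p x) ∧ ∑ x, p x = 1}

/-- The discrete Bayesian network model of `G` for variables `X_v` with finite state spaces `X v`:
the strictly positive joint distributions that factorize as `p(x) = ∏ v, κ_v(x_v | x_pa(v))`, where
each `κ_v(· | c)` is a probability vector on `X v`, for each configuration `c` of the parents. -/
def bayesNetModel {V : Type*} [Fintype V] [DecidableEq V] (X : V → Type*) [∀ v, Fintype (X v)]
    (G : Digraph V) : Set ((∀ v, X v) → ℝ) :=
  {p | p ∈ openSimplex (∀ v, X v) ∧
    ∃ κ : ∀ v : V, (∀ u : {u : V // G.Adj u v}, X u) → X v → ℝ,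
      (∀ v c a, 0 ≤ κ v c a) ∧ (∀ v c, ∑ a, κ v c a = 1) ∧
      ∀ x, p x = ∏ v, κ v (fun u => x u) (x v)}

/-- The class of all Bayesian network models for the variables `X_v`. -/
def bayesNetModels {V : Type*} [Fintype V] [DecidableEq V] (X : V → Type*)
    [∀ v, Fintype (X v)] : Set (Set ((∀ v, X v) → ℝ)) :=
  {M | ∃ G : Digraph V, G.IsDAG ∧ M = bayesNetModel X G}

/-! ### Tangent cones and overlap -/

/-- The tangent cone of `M` at `θ`: limits of `α n • (t n - θ)` with `α n > 0`, `t n ∈ M` and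
`t n → θ`. (`tangentConeAt ℝ` would also allow negative scalars.) -/
def modelTangentCone {E : Type*} [AddCommGroup E] [Module ℝ E] [TopologicalSpace E]
    (M : Set E) (θ : E) : Set E :=
  {h | ∃ (α : ℕ → ℝ) (t : ℕ → E), (∀ n, 0 < α n) ∧ (∀ n, t n ∈ M) ∧
    Tendsto t atTop (𝓝 θ) ∧ Tendsto (fun n => α n • (t n - θ)) atTop (𝓝 h)}

/-- `M₁` and `M₂` overlap at the common point `θ`: some vector is tangent at `θ` to both models
but not to their intersection. -/
def OverlapAt {E : Type*} [AddCommGroup E] [Module ℝ E] [TopologicalSpace E]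
    (M₁ M₂ : Set E) (θ : E) : Prop :=
  θ ∈ M₁ ∩ M₂ ∧ ∃ h, h ∈ modelTangentCone M₁ θ ∩ modelTangentCone M₂ θ ∧
    h ∉ modelTangentCone (M₁ ∩ M₂) θ

/-! ### Parameterizations and simultaneous convexity -/

/-- `ψ`, restricted to the open set `Θ`, is a parameterization of the set `D` of distributions:
a bijection of `Θ` onto `D` that is twice differentiable with Jacobian of full column rank. -/
structure IsParameterization {E F : Type*} [NormedAddCommGroup E] [NormedSpace ℝ E]
    [NormedAddCommGroup F] [NormedSpace ℝ F] (ψ : E → F) (Θ : Set E) (D : Set F) : Prop where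
  isOpen : IsOpen Θ
  bijOn : Set.BijOn ψ Θ D
  differentiableOn : DifferentiableOn ℝ ψ Θ
  twice_differentiableOn : DifferentiableOn ℝ (fderiv ℝ ψ) Θ
  full_rank : ∀ t ∈ Θ, Function.Injective (fderiv ℝ ψ t)

/-- The set `C` is convex in a neighbourhood of `η`. -/
def ConvexNear {E : Type*} [AddCommGroup E] [Module ℝ E] [TopologicalSpace E]
    (C : Set E) (η : E) : Prop :=
  ∃ N ∈ 𝓝 η, Convex ℝ (C ∩ N)

/-- There is a parameterization of the distributions on `S` in a neighbourhood `W` of `θ`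
(`W = Set.univ` is allowed and gives a parameterization of all of them) by an open set of
`ℝ^(|S| - 1)` under which every model in the class `𝓜` is convex in a neighbourhood of the
parameter of `θ`. -/
def SimultaneouslyConvexNear {S : Type*} [Fintype S] (𝓜 : Set (Set (S → ℝ))) (θ : S → ℝ) : Prop :=
  ∃ (W : Set (S → ℝ)) (Θ : Set (EuclideanSpace ℝ (Fin (Fintype.card S - 1))))
    (ψ : EuclideanSpace ℝ (Fin (Fintype.card S - 1)) → (S → ℝ)),
    IsOpen W ∧ IsParameterization ψ Θ (W ∩ openSimplex S) ∧
    ∃ η ∈ Θ, ψ η = θ ∧ ∀ M ∈ 𝓜, ConvexNear (Θ ∩ ψ ⁻¹' M) η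

/-!
Near a point of `M(G)`, the map replacing a distribution by the product of its conditional
distributions of each vertex given its parents is a differentiable retraction onto `M(G)`. Hence
every tangent cone of `M(G)` is a linear space. Under a parameterization that makes two models
convex near a point, a linear tangent cone consists of directions in which the convex set contains
a segment; a direction common to both cones is then tangent to the intersection. So overlap at a
common point rules out simultaneous convexity.

For the overlap, take nonzero functions `a`, `c`, `b` of `X_i`, `X_j`, `X_k` that sum to zero. At
the uniform distribution, `h(x) = (a(x_i) + c(x_j)) b(x_k)` is tangent to every model in which `i`
and `j` are both joined to `k`. Suppose `α n • (p n - θ) → h` with all `p n` in both models, and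
orient `i`, `j` so that `i` is not a descendant of `j`. By the local Markov property the second
order limit of the covariance of `a(X_i)` and `c(X_j)` is the pairing of `a h` with the conditional
mean of `c h` given the parents of `j`. That mean vanishes if `k` is not a parent of `j`, as for a
collider. For a noncollider `k` is a parent of `j`, the mean is a positive multiple of `b(x_k)`,
and the pairing is a positive sum of squares.
-/

/-! ### Summation along the order of a directed acyclic graph -/

section Sums

variable {V : Type*} [DecidableEq V] {X : V → Type*}

lemma apply_update_of_dependsOn {β : Type*} {F : (∀ v, X v) → β} {s : Set V} (hF : DependsOn F s)
    {v : V} (hv : v ∉ s) (x : ∀ v, X v) (a : X v) : F (Function.update x v a) = F x :=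
  hF fun _ hi => Function.update_of_ne (ne_of_mem_of_not_mem hi hv) _ _

variable [Fintype V] [∀ v, Fintype (X v)] {R : Type*} [CommSemiring R]

lemma sum_sum_update (v : V) (f : (∀ v, X v) → R) :
    ∑ x, ∑ a, f (Function.update x v a) = Fintype.card (X v) * ∑ x, f x := by
  have hswap : Function.Involutive
      (fun z : (∀ v, X v) × X v => (Function.update z.1 v z.2, z.1 v)) := fun z => by simp
  have hsum : ∑ z : (∀ v, X v) × X v, f (Function.update z.1 v z.2) =
      ∑ z : (∀ v, X v) × X v, f z.1 :=
    Fintype.sum_bijective _ hswap.bijective _ _ fun _ => rfl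
  simp only [Fintype.sum_prod_type] at hsum
  simp only [hsum, Finset.sum_const, Finset.card_univ, nsmul_eq_mul, Finset.mul_sum]

lemma card_mul_sum_mul_of_dependsOn {v : V} {F q : (∀ v, X v) → R} {s : R}
    (hF : DependsOn F {v}ᶜ) (hq : ∀ x, ∑ a, q (Function.update x v a) = s) :
    Fintype.card (X v) * ∑ x, F x * q x = s * ∑ x, F x := by
  rw [← sum_sum_update v fun x => F x * q x]
  simp only [apply_update_of_dependsOn hF (not_not_intro rfl), ← Finset.mul_sum, hq]
  rw [← Finset.sum_mul, mul_comm]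

/-- Sum out the variables in `D` one at a time, in order of decreasing rank. -/
lemma prod_card_mul_sum_mul_prod_of_rank (r : V → ℕ) {q : V → (∀ v, X v) → R}
    (hq : ∀ v, DependsOn (q v) (insert v {u | r u < r v})) {D : Finset V} {s : V → R}
    (hs : ∀ v ∈ D, ∀ x, ∑ a, q v (Function.update x v a) = s v) {F : (∀ v, X v) → R}
    (hF : DependsOn F (D : Set V)ᶜ) :
    (∏ v ∈ D, (Fintype.card (X v) : R)) * ∑ x, F x * ∏ v ∈ D, q v x =
      (∏ v ∈ D, s v) * ∑ x, F x := by
  induction D using Finset.induction_on_max_value r with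
  | empty => simp
  | insert w D hw hmax ih =>
    have hFw : DependsOn F {w}ᶜ := hF.mono (by simp)
    have hFD : DependsOn F (D : Set V)ᶜ := hF.mono (by simp)
    have hprod : DependsOn (fun x => F x * ∏ v ∈ D, q v x) {w}ᶜ := fun x y hxy => by
      have hqD : ∀ v ∈ D, q v x = q v y := fun v hv =>
        hq v fun u hu => hxy u <| by
          rintro rfl
          exact hu.elim (fun huv => hw (huv ▸ hv)) (hmax v hv).not_gt
      simp only [hFw hxy, Finset.prod_congr rfl hqD]
    have hsumw := card_mul_sum_mul_of_dependsOn hprod (hs w (Finset.mem_insert_self w D))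
    have hsumD := ih (fun v hv => hs v (Finset.mem_insert_of_mem hv)) hFD
    simp only [Finset.prod_insert hw]
    calc (Fintype.card (X w) : R) * (∏ v ∈ D, (Fintype.card (X v) : R)) *
          ∑ x, F x * (q w x * ∏ v ∈ D, q v x)
        = (∏ v ∈ D, (Fintype.card (X v) : R)) *
            (Fintype.card (X w) * ∑ x, F x * (∏ v ∈ D, q v x) * q w x) := by
          simp only [mul_left_comm, mul_comm, mul_assoc]
      _ = s w * ((∏ v ∈ D, (Fintype.card (X v) : R)) * ∑ x, F x * ∏ v ∈ D, q v x) := by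
          rw [hsumw, mul_left_comm]
      _ = s w * (∏ v ∈ D, s v) * ∑ x, F x := by rw [hsumD, mul_assoc]

lemma sum_mul_apply_eq_zero [IsDomain R] [CharZero R] {v : V} [Nonempty (X v)]
    {F : (∀ v, X v) → R} (hF : DependsOn F {v}ᶜ) {g : X v → R} (hg : ∑ a, g a = 0) :
    ∑ x, F x * g (x v) = 0 := by
  have hsum := card_mul_sum_mul_of_dependsOn hF (q := fun x => g (x v)) (s := 0)
    fun x => by simpa only [Function.update_self]
  rw [zero_mul] at hsum
  exact (mul_eq_zero.1 hsum).resolve_left (Nat.cast_ne_zero.2 Fintype.card_ne_zero)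

end Sums

lemma exists_rank_of_isDAG {V : Type*} [Finite V] {G : Digraph V} (hG : G.IsDAG) :
    ∃ r : V → ℕ, ∀ u v, G.Adj u v → r u < r v := by
  refine ⟨fun v => {u | Relation.TransGen G.Adj u v}.ncard, fun u v huv => ?_⟩
  refine Set.ncard_lt_ncard ⟨fun w hw => hw.tail huv, fun hsub => ?_⟩
  exact hG u (hsub (.single huv))

lemma not_reflTransGen_or_of_isDAG {V : Type*} {G : Digraph V} {i j : V} (hG : G.IsDAG)
    (hij : i ≠ j) : ¬ Relation.ReflTransGen G.Adj j i ∨ ¬ Relation.ReflTransGen G.Adj i j := by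
  by_contra! hboth
  obtain ⟨hji, hij'⟩ := hboth
  exact hG i (((Relation.reflTransGen_iff_eq_or_transGen.1 hij').resolve_left hij.symm).trans_left
    hji)

/-! ### The local Markov property -/

/-- Families of conditional tables for `G`, indexed by a vertex, a configuration of its parents
and a state, with no condition of positivity or normalization. -/
abbrev ConditionalTables {V : Type*} (X : V → Type*) (G : Digraph V) : Type _ :=
  ∀ v : V, (∀ u : {u : V // G.Adj u v}, X u) → X v → ℝ

/-- The configuration of the parents of `v` in `G`, written `x_pa(v)` in the factorization. -/
def parentConfig {V : Type*} {X : V → Type*} (G : Digraph V) (v : V) (x : ∀ v, X v) :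
    ∀ u : {u : V // G.Adj u v}, X u :=
  fun u => x u

/-- The product `∏ v, κ_v(x_v | x_pa(v))` of a family of conditional tables. -/
def jointOfTables {V : Type*} [Fintype V] {X : V → Type*} {G : Digraph V}
    (κ : ConditionalTables X G) (x : ∀ v, X v) : ℝ :=
  ∏ v, κ v (parentConfig G v x) (x v)

lemma dependsOn_parentConfig {V : Type*} {X : V → Type*} (G : Digraph V) (v : V) :
    DependsOn (parentConfig (X := X) G v) {u | G.Adj u v} :=
  fun _ _ h => funext fun u => h u u.2

lemma dependsOn_comp_parentConfig {V : Type*} {X : V → Type*} {β : Type*} {G : Digraph V}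
    (hG : G.IsDAG) (v : V) (φ : (∀ u : {u : V // G.Adj u v}, X u) → β) :
    DependsOn (fun x : ∀ v, X v => φ (parentConfig G v x))
      {u | Relation.ReflTransGen G.Adj v u}ᶜ := fun x y hxy => by
  simp only [dependsOn_parentConfig G v fun u hu => hxy u fun hvu => hG v (.tail' hvu hu)]

lemma exists_parentConfig_eq {V : Type*} {X : V → Type*} [∀ v, Nonempty (X v)] (G : Digraph V)
    (v : V) (c : ∀ u : {u : V // G.Adj u v}, X u) : ∃ x, parentConfig G v x = c := by
  classical
  exact ⟨fun u => if h : G.Adj u v then c ⟨u, h⟩ else Classical.arbitrary _,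
    funext fun u => dif_pos u.2⟩

section Markov

variable {V : Type*} [Fintype V] [DecidableEq V] {X : V → Type*} {G : Digraph V}

lemma jointOfTables_update_mul (κ : ConditionalTables X G) (v : V)
    (w : (∀ u : {u : V // G.Adj u v}, X u) → X v → ℝ) (x : ∀ v, X v) :
    jointOfTables (Function.update κ v fun c a => κ v c a * w c a) x =
      jointOfTables κ x * w (parentConfig G v x) (x v) := by
  rw [jointOfTables, jointOfTables, Fintype.prod_eq_mul_prod_compl v,
    Fintype.prod_eq_mul_prod_compl v, Function.update_self, mul_right_comm]
  congr 2
  refine Finset.prod_congr rfl fun u hu => ?_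
  rw [Function.update_of_ne (by simpa using hu)]

variable [∀ v, Fintype (X v)]

lemma prod_card_mul_sum_mul_jointOfTables (hG : G.IsDAG) (κ : ConditionalTables X G)
    {D : Finset V} (hD : ∀ u ∈ D, ∀ v, G.Adj u v → v ∈ D) {s : V → ℝ}
    (hs : ∀ v ∈ D, ∀ c, ∑ a, κ v c a = s v) {F : (∀ v, X v) → ℝ}
    (hF : DependsOn F (D : Set V)ᶜ) :
    (∏ v ∈ D, (Fintype.card (X v) : ℝ)) * ∑ x, F x * jointOfTables κ x =
      (∏ v ∈ D, s v) * ∑ x, F x * ∏ v ∈ Dᶜ, κ v (parentConfig G v x) (x v) := by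
  obtain ⟨r, hr⟩ := exists_rank_of_isDAG hG
  set q : V → (∀ v, X v) → ℝ := fun v x => κ v (parentConfig G v x) (x v)
  have hq (v : V) : DependsOn (q v) (insert v {u | G.Adj u v}) := fun x y hxy => by
    simp only [q, dependsOn_parentConfig G v fun u hu => hxy u (.inr hu), hxy v (.inl rfl)]
  have hFq : DependsOn (fun x => F x * ∏ v ∈ Dᶜ, q v x) (D : Set V)ᶜ := fun x y hxy => by
    have hqD : ∀ v ∈ Dᶜ, q v x = q v y := fun v hv => hq v fun u hu => hxy u fun huD =>
      Finset.mem_compl.1 hv (hu.elim (fun huv => huv ▸ huD) (hD u huD v))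
    simp only [hF hxy, Finset.prod_congr rfl hqD]
  have hsum := prod_card_mul_sum_mul_prod_of_rank r
    (fun v => (hq v).mono (Set.insert_subset_insert fun u => hr u v)) (s := s)
    (fun v hv x => by
      simp only [q, apply_update_of_dependsOn (dependsOn_parentConfig G v)
        (fun h : G.Adj v v => hG v (.single h)), Function.update_self, hs v hv]) hFq
  rw [← hsum]
  congr 1
  refine Finset.sum_congr rfl fun x _ => ?_
  rw [jointOfTables, ← Finset.prod_compl_mul_prod D, mul_assoc]

variable [∀ v, Nonempty (X v)]

lemma sum_jointOfTables (hG : G.IsDAG) {κ : ConditionalTables X G}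
    (hκ : ∀ v c, ∑ a, κ v c a = 1) : ∑ x, jointOfTables κ x = 1 := by
  have hcard : (∏ v, (Fintype.card (X v) : ℝ)) ≠ 0 :=
    Finset.prod_ne_zero_iff.2 fun v _ => Nat.cast_ne_zero.2 Fintype.card_ne_zero
  have hsum := prod_card_mul_sum_mul_jointOfTables hG κ (D := Finset.univ) (by simp)
    (s := fun _ => 1) (fun v _ => hκ v) (F := fun _ => 1) fun _ _ _ => rfl
  refine mul_left_cancel₀ hcard ?_
  simpa using hsum

/-- The residual of `g(X_j)` given the parents of `j` is orthogonal to the functions of the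
nondescendants of `j`, because the tables reweighted by the residual have zero row sums at `j`. -/
lemma sum_mul_jointOfTables_mul_residual (hG : G.IsDAG) {κ : ConditionalTables X G}
    (hκ : ∀ v c, ∑ a, κ v c a = 1) {j : V} {F : (∀ v, X v) → ℝ}
    (hF : DependsOn F {v | Relation.ReflTransGen G.Adj j v}ᶜ) (g : X j → ℝ) :
    ∑ x, F x * (jointOfTables κ x * (g (x j) - ∑ a, κ j (parentConfig G j x) a * g a)) = 0 := by
  classical
  set D : Finset V := {v | Relation.ReflTransGen G.Adj j v}
  have hjD : j ∈ D := by simp [D, Relation.ReflTransGen.refl]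
  have hD : ∀ u ∈ D, ∀ v, G.Adj u v → v ∈ D := fun u hu v huv => by
    simp only [D, Finset.mem_filter_univ] at hu ⊢
    exact hu.tail huv
  have hcard : (∏ v ∈ D, (Fintype.card (X v) : ℝ)) ≠ 0 :=
    Finset.prod_ne_zero_iff.2 fun v _ => Nat.cast_ne_zero.2 Fintype.card_ne_zero
  set κ' : ConditionalTables X G :=
    Function.update κ j fun c a => κ j c a * (g a - ∑ b, κ j c b * g b)
  have hκ' : ∀ v ∈ D, ∀ c, ∑ a, κ' v c a = Function.update (1 : V → ℝ) j 0 v := by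
    intro v _ c
    rcases eq_or_ne v j with rfl | hvj
    · simp only [κ', Function.update_self, mul_sub, Finset.sum_sub_distrib, ← Finset.sum_mul, hκ,
        one_mul, sub_self]
    · simp only [κ', Function.update_of_ne hvj, hκ, Pi.one_apply]
  have hsum := prod_card_mul_sum_mul_jointOfTables hG κ' hD hκ' (F := F) (by simpa [D] using hF)
  have hprod : ∏ v ∈ D, Function.update (1 : V → ℝ) j 0 v = 0 :=
    Finset.prod_eq_zero hjD (Function.update_self _ _ _)
  rw [hprod, zero_mul] at hsum
  simpa only [κ', jointOfTables_update_mul] using (mul_eq_zero.1 hsum).resolve_left hcard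

end Markov

/-! ### Conditional means and the projection onto the model -/

section Projection

variable {V : Type*} [Fintype V] [DecidableEq V] {X : V → Type*} [∀ v, Fintype (X v)]

/-- The sum of `f` over the configurations `x` with `x_pa(v) = c`. -/
noncomputable def parentSum (G : Digraph V) (v : V) (c : ∀ u : {u : V // G.Adj u v}, X u)
    (f : (∀ v, X v) → ℝ) : ℝ :=
  ∑ x, Set.indicator {c} 1 (parentConfig G v x) * f x

/-- The conditional mean of `g(X_v)` given `X_pa(v) = c` under the positive weights `p`. -/
noncomputable def parentCondMean (G : Digraph V) (p : (∀ v, X v) → ℝ) (v : V) (g : X v → ℝ)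
    (c : ∀ u : {u : V // G.Adj u v}, X u) : ℝ :=
  parentSum G v c (fun x => p x * g (x v)) / parentSum G v c p

/-- The conditional distributions `p(X_v = a | X_pa(v) = c)` of `p`. -/
noncomputable def conditionalTables (G : Digraph V) (p : (∀ v, X v) → ℝ) : ConditionalTables X G :=
  fun v c a => parentCondMean G p v (Set.indicator {a} 1) c

/-- The distribution in the model of `G` with the same conditional distributions of each vertex
given its parents as `p`. -/
noncomputable def markovProjection (G : Digraph V) (p : (∀ v, X v) → ℝ) : (∀ v, X v) → ℝ :=
  jointOfTables (conditionalTables G p)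

variable {G : Digraph V} {p : (∀ v, X v) → ℝ}

lemma parentSum_pos {v : V} {c : ∀ u : {u : V // G.Adj u v}, X u} {f : (∀ v, X v) → ℝ}
    (hf : ∀ x, 0 ≤ f x) {x : ∀ v, X v} (hc : parentConfig G v x = c) (hx : 0 < f x) :
    0 < parentSum G v c f := by
  refine Finset.sum_pos' (fun y _ => ?_) ⟨x, Finset.mem_univ x, by simpa [hc] using hx⟩
  exact mul_nonneg (Set.indicator_nonneg (fun _ _ => zero_le_one) _) (hf y)

lemma parentSum_pos_of_pos [∀ v, Nonempty (X v)] {v : V} {c : ∀ u : {u : V // G.Adj u v}, X u}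
    {f : (∀ v, X v) → ℝ} (hf : ∀ x, 0 < f x) : 0 < parentSum G v c f := by
  obtain ⟨x, hx⟩ := exists_parentConfig_eq G v c
  exact parentSum_pos (fun y => (hf y).le) hx (hf x)

lemma jointOfTables_mem_bayesNetModel [∀ v, Nonempty (X v)] (hG : G.IsDAG)
    {κ : ConditionalTables X G} (hκ : ∀ v c a, 0 < κ v c a) (hsum : ∀ v c, ∑ a, κ v c a = 1) :
    jointOfTables κ ∈ bayesNetModel X G :=
  ⟨⟨fun _ => Finset.prod_pos fun v _ => hκ v _ _, sum_jointOfTables hG hsum⟩,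
    κ, fun v c a => (hκ v c a).le, hsum, fun _ => rfl⟩

lemma parentCondMean_jointOfTables [∀ v, Nonempty (X v)] (hG : G.IsDAG)
    {κ : ConditionalTables X G} (hsum : ∀ v c, ∑ a, κ v c a = 1)
    (hpos : ∀ x, 0 < jointOfTables κ x) (v : V) (g : X v → ℝ)
    (c : ∀ u : {u : V // G.Adj u v}, X u) :
    parentCondMean G (jointOfTables κ) v g c = ∑ a, κ v c a * g a := by
  rw [parentCondMean, div_eq_iff (parentSum_pos_of_pos hpos).ne', parentSum, parentSum,
    Finset.mul_sum, ← sub_eq_zero, ← Finset.sum_sub_distrib]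
  rw [← sum_mul_jointOfTables_mul_residual hG hsum
    (dependsOn_comp_parentConfig hG v (Set.indicator {c} 1)) g]
  refine Finset.sum_congr rfl fun x _ => ?_
  rcases eq_or_ne (parentConfig G v x) c with rfl | hx
  · ring
  · simp [hx]

/-- The local Markov property. -/
lemma sum_mul_mul_eq_sum_mul_parentCondMean [∀ v, Nonempty (X v)] (hG : G.IsDAG)
    (hp : p ∈ bayesNetModel X G) {v : V} {F : (∀ v, X v) → ℝ}
    (hF : DependsOn F {u | Relation.ReflTransGen G.Adj v u}ᶜ) (g : X v → ℝ) :
    ∑ x, F x * (p x * g (x v)) =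
      ∑ x, F x * (p x * parentCondMean G p v g (parentConfig G v x)) := by
  obtain ⟨⟨hpos, -⟩, κ, -, hsum, hfac⟩ := hp
  obtain rfl : p = jointOfTables κ := funext hfac
  simp only [parentCondMean_jointOfTables hG hsum hpos]
  rw [← sub_eq_zero, ← Finset.sum_sub_distrib, ← sum_mul_jointOfTables_mul_residual hG hsum hF g]
  exact Finset.sum_congr rfl fun x _ => by ring

lemma sum_conditionalTables [∀ v, Nonempty (X v)] (hp : ∀ x, 0 < p x) (v : V)
    (c : ∀ u : {u : V // G.Adj u v}, X u) : ∑ a, conditionalTables G p v c a = 1 := by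
  have hone (x : ∀ v, X v) : ∑ a, Set.indicator {a} (1 : X v → ℝ) (x v) = 1 := by
    classical simp [Set.indicator_apply]
  simp only [conditionalTables, parentCondMean, parentSum]
  rw [← Finset.sum_div, Finset.sum_comm]
  simp only [← Finset.mul_sum, hone, mul_one]
  exact div_self (parentSum_pos_of_pos hp).ne'

lemma conditionalTables_pos [∀ v, Nonempty (X v)] (hG : G.IsDAG) (hp : ∀ x, 0 < p x) (v : V)
    (c : ∀ u : {u : V // G.Adj u v}, X u) (a : X v) : 0 < conditionalTables G p v c a := by
  obtain ⟨x, hx⟩ := exists_parentConfig_eq G v c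
  have hc : parentConfig G v (Function.update x v a) = c := by
    rw [← hx]
    exact apply_update_of_dependsOn (dependsOn_parentConfig G v) (fun h => hG v (.single h)) x a
  refine div_pos (parentSum_pos (fun y => ?_) hc ?_) (parentSum_pos_of_pos hp)
  · exact mul_nonneg (hp y).le (Set.indicator_nonneg (fun _ _ => zero_le_one) _)
  · simpa using hp _

lemma markovProjection_mem [∀ v, Nonempty (X v)] (hG : G.IsDAG) (hp : ∀ x, 0 < p x) :
    markovProjection G p ∈ bayesNetModel X G :=
  jointOfTables_mem_bayesNetModel hG (conditionalTables_pos hG hp) (sum_conditionalTables hp)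

lemma markovProjection_eq_self [∀ v, Nonempty (X v)] (hG : G.IsDAG) (hp : p ∈ bayesNetModel X G) :
    markovProjection G p = p := by
  classical
  obtain ⟨⟨hpos, -⟩, κ, -, hsum, hfac⟩ := hp
  obtain rfl : p = jointOfTables κ := funext hfac
  funext x
  refine Finset.prod_congr rfl fun v _ => ?_
  rw [conditionalTables, parentCondMean_jointOfTables hG hsum hpos]
  simp [Set.indicator_apply]

lemma differentiableAt_markovProjection [∀ v, Nonempty (X v)] (hp : ∀ x, 0 < p x) :
    DifferentiableAt ℝ (markovProjection G) p := by
  have hsum (v : V) (c : ∀ u : {u : V // G.Adj u v}, X u) : DifferentiableAt ℝ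
      (fun q : (∀ v, X v) → ℝ => (parentSum G v c q)⁻¹) p := by
    refine DifferentiableAt.inv ?_ (parentSum_pos_of_pos hp).ne'
    unfold parentSum
    fun_prop
  have hcond (x : ∀ v, X v) (v : V) :
      DifferentiableAt ℝ (fun q => conditionalTables G q v (parentConfig G v x) (x v)) p := by
    simp only [conditionalTables, parentCondMean, div_eq_mul_inv]
    refine DifferentiableAt.mul ?_ (hsum v _)
    unfold parentSum
    fun_prop
  exact differentiableAt_pi.2 fun x =>
    (HasFDerivAt.finsetProd fun v _ => (hcond x v).hasFDerivAt).differentiableAt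

end Projection

/-! ### Tangent cones -/

section FeasibleDirections

variable {E : Type*} [AddCommGroup E] [Module ℝ E] {M N : Set E} {θ k : E}

/-- The directions `k` in which `M` contains an initial piece of the open ray `θ + ε • k`. -/
def feasibleDirections (M : Set E) (θ : E) : Set E :=
  {k | ∀ᶠ ε in 𝓝[>] (0 : ℝ), θ + ε • k ∈ M}

lemma mem_feasibleDirections :
    k ∈ feasibleDirections M θ ↔ ∀ᶠ ε in 𝓝[>] (0 : ℝ), θ + ε • k ∈ M :=
  Iff.rfl

lemma feasibleDirections_inter :
    feasibleDirections (M ∩ N) θ = feasibleDirections M θ ∩ feasibleDirections N θ := by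
  ext k
  simp only [mem_feasibleDirections, Set.mem_inter_iff, eventually_and]

lemma convex_feasibleDirections (hM : Convex ℝ M) : Convex ℝ (feasibleDirections M θ) := by
  intro k hk l hl s t hs ht hst
  rw [mem_feasibleDirections] at hk hl ⊢
  filter_upwards [hk, hl] with ε hεk hεl
  convert hM hεk hεl hs ht hst using 1
  linear_combination (norm := module) -hst • θ

lemma sub_mem_feasibleDirections (hM : Convex ℝ M) (hθ : θ ∈ M) {c : E} (hc : c ∈ M) :
    c - θ ∈ feasibleDirections M θ := by
  rw [mem_feasibleDirections]
  filter_upwards [Ioc_mem_nhdsGT one_pos] with ε hε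
  exact hM.add_smul_sub_mem hθ hc ⟨hε.1.le, hε.2⟩

lemma smul_mem_feasibleDirections (hk : k ∈ feasibleDirections M θ) {r : ℝ} (hr : 0 < r) :
    r • k ∈ feasibleDirections M θ := by
  have hmul : Tendsto (fun ε : ℝ => ε * r) (𝓝[>] 0) (𝓝[>] 0) := by
    refine tendsto_nhdsWithin_iff.2 ⟨?_, eventually_mem_nhdsWithin.mono fun ε hε => mul_pos hε hr⟩
    exact ((continuous_mul_const r).tendsto' 0 0 (zero_mul r)).mono_left nhdsWithin_le_nhds
  exact (hmul.eventually hk).mono fun ε hε => by rwa [smul_smul]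

end FeasibleDirections

section TangentCone

variable {E : Type*} [AddCommGroup E] [Module ℝ E] [TopologicalSpace E] {M N : Set E} {θ h : E}

lemma mem_modelTangentCone_of_eventually {α : ℕ → ℝ} {t : ℕ → E} (hα : ∀ᶠ n in atTop, 0 < α n)
    (htM : ∀ᶠ n in atTop, t n ∈ M) (ht : Tendsto t atTop (𝓝 θ))
    (hlim : Tendsto (fun n => α n • (t n - θ)) atTop (𝓝 h)) : h ∈ modelTangentCone M θ := by
  obtain ⟨m, hm⟩ := eventually_atTop.1 (hα.and htM)
  exact ⟨fun n => α (n + m), fun n => t (n + m), fun n => (hm _ (Nat.le_add_left _ _)).1,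
    fun n => (hm _ (Nat.le_add_left _ _)).2, ht.comp (tendsto_add_atTop_nat m),
    hlim.comp (tendsto_add_atTop_nat m)⟩

lemma modelTangentCone_mono (hMN : M ⊆ N) : modelTangentCone M θ ⊆ modelTangentCone N θ := by
  rintro h ⟨α, t, hα, ht, htθ, hlim⟩
  exact ⟨α, t, hα, fun n => hMN (ht n), htθ, hlim⟩

lemma modelTangentCone_inter_of_mem_nhds (hN : N ∈ 𝓝 θ) :
    modelTangentCone (M ∩ N) θ = modelTangentCone M θ := by
  refine (modelTangentCone_mono Set.inter_subset_left).antisymm ?_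
  rintro h ⟨α, t, hα, ht, htθ, hlim⟩
  exact mem_modelTangentCone_of_eventually (.of_forall hα)
    ((htθ.eventually hN).mono fun n hn => ⟨ht n, hn⟩) htθ hlim

variable [IsTopologicalAddGroup E] [ContinuousSMul ℝ E]

lemma feasibleDirections_subset_modelTangentCone :
    feasibleDirections M θ ⊆ modelTangentCone M θ := by
  intro k hk
  have hpos (n : ℕ) : (0 : ℝ) < n + 1 := by positivity
  have hε : Tendsto (fun n : ℕ => 1 / ((n : ℝ) + 1)) atTop (𝓝[>] 0) :=
    tendsto_nhdsWithin_iff.2 ⟨tendsto_one_div_add_atTop_nhds_zero_nat,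
      .of_forall fun n => one_div_pos.2 (hpos n)⟩
  refine mem_modelTangentCone_of_eventually (.of_forall hpos) (hε.eventually hk) ?_ ?_
  · have hcont : Continuous fun ε : ℝ => θ + ε • k := by fun_prop
    exact (hcont.tendsto' 0 θ (by simp)).comp tendsto_one_div_add_atTop_nhds_zero_nat
  · refine tendsto_const_nhds.congr fun n => ?_
    rw [add_sub_cancel_left, smul_smul, mul_one_div_cancel (hpos n).ne', one_smul]

end TangentCone

section Convex

variable {E : Type*} [NormedAddCommGroup E] [NormedSpace ℝ E] {C C₁ C₂ : Set E} {η : E}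

lemma modelTangentCone_subset_closure_feasibleDirections (hC : Convex ℝ C) (hη : η ∈ C) :
    modelTangentCone C η ⊆ closure (feasibleDirections C η) := by
  rintro h ⟨α, t, hα, ht, -, hlim⟩
  exact mem_closure_of_tendsto hlim <| .of_forall fun n =>
    smul_mem_feasibleDirections (sub_mem_feasibleDirections hC hη (ht n)) (hα n)

variable [FiniteDimensional ℝ E]

lemma eq_univ_of_convex_of_dense {K : Set E} (hK : Convex ℝ K) (hdense : Dense K) :
    K = Set.univ := by
  have hspan : affineSpan ℝ K = ⊤ := by
    have hclosed : IsClosed (affineSpan ℝ K : Set E) := AffineSubspace.closed_of_finiteDimensional _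
    refine SetLike.coe_injective ?_
    rw [← hclosed.closure_eq, (hdense.mono (subset_affineSpan ℝ K)).closure_eq,
      AffineSubspace.top_coe]
  have hint := hK.interior_closure_eq_interior_of_nonempty_interior
    (hK.interior_nonempty_iff_affineSpan_eq_top.2 hspan)
  rw [hdense.closure_eq, interior_univ] at hint
  exact Set.univ_subset_iff.1 (hint ▸ interior_subset)

lemma eq_coe_of_convex_of_subset_closure {K : Set E} {L : Submodule ℝ E} (hK : Convex ℝ K)
    (hKL : K ⊆ L) (hLK : (L : Set E) ⊆ closure K) : K = L := by
  have hdense : Dense ((↑) ⁻¹' K : Set L) := by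
    refine Subtype.dense_iff.2 (hLK.trans (closure_mono ?_))
    exact fun x hx => ⟨⟨x, hKL hx⟩, hx, rfl⟩
  have huniv := eq_univ_of_convex_of_dense (hK.linear_preimage L.subtype) hdense
  exact hKL.antisymm fun x hx => huniv.ge (Set.mem_univ (⟨x, hx⟩ : L))

/-- A dense convex subset of a finite-dimensional space is the whole space, so a tangent cone that
is linear consists of directions in which the set contains a segment. -/
lemma ConvexNear.modelTangentCone_subset_feasibleDirections (hC : ConvexNear C η) (hη : η ∈ C)
    {L : Submodule ℝ E} (hL : modelTangentCone C η = L) :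
    modelTangentCone C η ⊆ feasibleDirections C η := by
  obtain ⟨N, hN, hCN⟩ := hC
  have hηN : η ∈ C ∩ N := ⟨hη, mem_of_mem_nhds hN⟩
  have hLN : modelTangentCone (C ∩ N) η = L := by rw [modelTangentCone_inter_of_mem_nhds hN, hL]
  have hfeas : feasibleDirections (C ∩ N) η = L :=
    eq_coe_of_convex_of_subset_closure (convex_feasibleDirections hCN)
      (hLN ▸ feasibleDirections_subset_modelTangentCone)
      (hLN ▸ modelTangentCone_subset_closure_feasibleDirections hCN hηN)
  rw [hL, ← hfeas, feasibleDirections_inter]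
  exact Set.inter_subset_left

lemma not_overlapAt_of_convexNear (hC₁ : ConvexNear C₁ η) (hC₂ : ConvexNear C₂ η)
    {L₁ L₂ : Submodule ℝ E} (hL₁ : modelTangentCone C₁ η = L₁)
    (hL₂ : modelTangentCone C₂ η = L₂) : ¬ OverlapAt C₁ C₂ η := by
  rintro ⟨⟨hη₁, hη₂⟩, k, ⟨hk₁, hk₂⟩, hk⟩
  refine hk (feasibleDirections_subset_modelTangentCone ?_)
  rw [feasibleDirections_inter]
  exact ⟨hC₁.modelTangentCone_subset_feasibleDirections hη₁ hL₁ hk₁,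
    hC₂.modelTangentCone_subset_feasibleDirections hη₂ hL₂ hk₂⟩

end Convex

section Derivative

variable {E F : Type*} [NormedAddCommGroup E] [NormedSpace ℝ E] [NormedAddCommGroup F]
  [NormedSpace ℝ F] {M : Set E} {N : Set F} {f : E → F} {f' : E →L[ℝ] F} {θ : E}

lemma modelTangentCone_subset_tangentConeAt : modelTangentCone M θ ⊆ tangentConeAt ℝ M θ := by
  rintro h ⟨α, t, -, ht, htθ, hlim⟩
  exact mem_tangentConeAt_of_seq atTop α (fun n => t n - θ) (tendsto_sub_nhds_zero_iff.2 htθ)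
    (.of_forall fun n => by simpa using ht n) hlim

lemma mapsTo_modelTangentCone (hf : HasFDerivWithinAt f f' M θ)
    (hMN : ∀ᶠ t in 𝓝[M] θ, f t ∈ N) :
    Set.MapsTo f' (modelTangentCone M θ) (modelTangentCone N (f θ)) := by
  rintro h ⟨α, t, hα, ht, htθ, hlim⟩
  have htM : Tendsto t atTop (𝓝[M] θ) := tendsto_nhdsWithin_iff.2 ⟨htθ, .of_forall ht⟩
  refine mem_modelTangentCone_of_eventually (.of_forall hα) (htM.eventually hMN)
    (hf.continuousWithinAt.tendsto.comp htM) ?_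
  simpa using hf.lim (tendsto_sub_nhds_zero_iff.2 htθ) (.of_forall fun n => by simpa using ht n)
    hlim

lemma modelTangentCone_subset_of_sub_mem {L : Submodule ℝ E} (hL : IsClosed (L : Set E))
    (hM : ∀ t ∈ M, t - θ ∈ L) : modelTangentCone M θ ⊆ L := by
  rintro h ⟨α, t, -, ht, -, hlim⟩
  exact hL.mem_of_tendsto hlim (.of_forall fun n => L.smul_mem _ (hM _ (ht n)))

lemma modelTangentCone_eq_of_retraction {T : E → E} {T' : E →L[ℝ] E} (hT : HasFDerivAt T T' θ)
    (hmem : ∀ᶠ t in 𝓝 θ, T t ∈ M) (hid : Set.EqOn T id M) (hθ : θ ∈ M) :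
    modelTangentCone M θ = LinearMap.eqLocus (T' : E →ₗ[ℝ] E) LinearMap.id := by
  refine Set.Subset.antisymm (fun h hh => ?_) fun h hh => ?_
  · exact hT.hasFDerivWithinAt.unique_on ((hasFDerivWithinAt_id θ M).congr hid (hid hθ))
      (modelTangentCone_subset_tangentConeAt hh)
  · have hmaps := mapsTo_modelTangentCone (hT.hasFDerivWithinAt (s := Set.univ)) (N := M)
      (by rwa [nhdsWithin_univ])
    have hTh : T' h = h := hh
    have hTθ : T θ = θ := hid hθ
    rw [hTθ] at hmaps
    rw [← hTh]
    exact hmaps (feasibleDirections_subset_modelTangentCone <|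
      mem_feasibleDirections.2 <| .of_forall fun _ => Set.mem_univ _)

variable [CompleteSpace E] {ψ : E → F} {η : E}

/-- For a continuous left inverse `P` of `f'`, the local inverse of `P ∘ ψ` is a local inverse of
`ψ` on any set whose displacements from `ψ` lie in the range of `f'`, on which `P` is injective. -/
lemma exists_hasFDerivAt_local_rightInverse (hψ : HasStrictFDerivAt ψ f' η)
    (hf' : f'.HasLeftInverse) (hN : ∀ᶠ s in 𝓝 η, ∀ t ∈ N, ψ s - t ∈ Set.range f') :
    ∃ (χ : F → E) (χ' : F →L[ℝ] E), HasFDerivAt χ χ' (ψ η) ∧ χ (ψ η) = η ∧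
      Function.LeftInverse χ' f' ∧ ∀ᶠ t in 𝓝[N] ψ η, ψ (χ t) = t := by
  obtain ⟨P, hP⟩ := hf'
  have hPψ : HasStrictFDerivAt (P ∘ ψ)
      ((ContinuousLinearEquiv.refl ℝ E : E ≃L[ℝ] E) : E →L[ℝ] E) η :=
    (P.hasStrictFDerivAt.comp η hψ).congr_fderiv (ContinuousLinearMap.ext hP)
  set χ₀ := hPψ.localInverse (P ∘ ψ) _ η
  have hχ₀ : χ₀ (P (ψ η)) = η := hPψ.localInverse_apply_image
  have hχ : HasFDerivAt (χ₀ ∘ P) P (ψ η) :=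
    (hPψ.to_localInverse.hasFDerivAt.comp (ψ η) P.hasFDerivAt).congr_fderiv (by ext; rfl)
  refine ⟨χ₀ ∘ P, P, hχ, hχ₀, hP, ?_⟩
  have hχtendsto : Tendsto (χ₀ ∘ P) (𝓝 (ψ η)) (𝓝 η) := by
    simpa [hχ₀] using hχ.continuousAt.tendsto
  have hright : ∀ᶠ t in 𝓝 (ψ η), P (ψ (χ₀ (P t))) = P t :=
    P.continuous.continuousAt.eventually hPψ.eventually_right_inverse
  filter_upwards [nhdsWithin_le_nhds (hχtendsto.eventually hN), nhdsWithin_le_nhds hright,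
    self_mem_nhdsWithin] with t hrange hPt htN
  obtain ⟨z, hz⟩ := hrange t htN
  have hz0 : z = 0 := by rw [← hP z, hz, map_sub, sub_eq_zero]; exact hPt
  rw [← sub_eq_zero, Function.comp_apply, ← Function.comp_apply (f := χ₀), ← hz, hz0, map_zero]

lemma modelTangentCone_preimage (hψ : HasStrictFDerivAt ψ f' η) (hf' : f'.HasLeftInverse)
    {Θ : Set E} (hΘ : Θ ∈ 𝓝 η) (hN : ∀ᶠ s in 𝓝 η, ∀ t ∈ N, ψ s - t ∈ Set.range f') :
    modelTangentCone (Θ ∩ ψ ⁻¹' N) η = f' ⁻¹' modelTangentCone N (ψ η) := by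
  refine Set.Subset.antisymm ?_ fun k hk => ?_
  · exact mapsTo_modelTangentCone hψ.hasFDerivAt.hasFDerivWithinAt
      (eventually_mem_nhdsWithin.mono fun s hs => hs.2)
  · obtain ⟨χ, χ', hχ, hχη, hχ', hright⟩ := exists_hasFDerivAt_local_rightInverse hψ hf' hN
    have hχΘ : ∀ᶠ t in 𝓝[N] ψ η, χ t ∈ Θ :=
      nhdsWithin_le_nhds (hχ.continuousAt.eventually (hχη.symm ▸ hΘ))
    have hmaps := mapsTo_modelTangentCone (N := Θ ∩ ψ ⁻¹' N) hχ.hasFDerivWithinAt <| by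
      filter_upwards [hχΘ, hright, self_mem_nhdsWithin] with t htΘ ht htN
      exact ⟨htΘ, by rwa [Set.mem_preimage, ht]⟩
    simpa only [hχ' k, hχη] using hmaps hk

lemma OverlapAt.preimage {N₁ N₂ : Set F} (hov : OverlapAt N₁ N₂ (ψ η))
    (hψ : HasStrictFDerivAt ψ f' η) (hf' : f'.HasLeftInverse) {Θ : Set E} (hΘ : Θ ∈ 𝓝 η)
    (hN₁ : ∀ᶠ s in 𝓝 η, ∀ t ∈ N₁, ψ s - t ∈ Set.range f')
    (hN₂ : ∀ᶠ s in 𝓝 η, ∀ t ∈ N₂, ψ s - t ∈ Set.range f') :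
    OverlapAt (Θ ∩ ψ ⁻¹' N₁) (Θ ∩ ψ ⁻¹' N₂) η := by
  obtain ⟨⟨hη₁, hη₂⟩, h, ⟨hh₁, hh₂⟩, hh⟩ := hov
  obtain ⟨k, rfl⟩ : h ∈ f'.range :=
    modelTangentCone_subset_of_sub_mem (L := f'.range) hf'.isClosed_range
      (fun t ht => sub_mem_comm_iff.1 (hN₁.self_of_nhds t ht)) hh₁
  have hη := mem_of_mem_nhds hΘ
  refine ⟨⟨⟨hη, hη₁⟩, hη, hη₂⟩, k, ⟨?_, ?_⟩, ?_⟩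
  · rwa [modelTangentCone_preimage hψ hf' hΘ hN₁]
  · rwa [modelTangentCone_preimage hψ hf' hΘ hN₂]
  · rw [← Set.inter_inter_distrib_left, ← Set.preimage_inter,
      modelTangentCone_preimage hψ hf' hΘ (hN₁.mono fun s hs t ht => hs t ht.1)]
    exact hh

end Derivative

/-! ### Tangent vectors of Bayesian network models -/

lemma exists_submodule_modelTangentCone_eq {V : Type*} [Fintype V] [DecidableEq V] {X : V → Type*}
    [∀ v, Fintype (X v)] [∀ v, Nonempty (X v)] {G : Digraph V} (hG : G.IsDAG)
    {θ : (∀ v, X v) → ℝ} (hθ : θ ∈ bayesNetModel X G) :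
    ∃ L : Submodule ℝ ((∀ v, X v) → ℝ), modelTangentCone (bayesNetModel X G) θ = L := by
  have hpos : ∀ᶠ p in 𝓝 θ, ∀ x, 0 < p x :=
    eventually_all.2 fun x => (continuous_apply x).continuousAt.eventually_const_lt (hθ.1.1 x)
  exact ⟨_, modelTangentCone_eq_of_retraction
    (differentiableAt_markovProjection (G := G) hθ.1.1).hasFDerivAt
    (hpos.mono fun p hp => markovProjection_mem hG hp)
    (fun p hp => markovProjection_eq_self hG hp) hθ⟩

/-- The uniform distribution on `S`, as a vector of probabilities. -/
noncomputable def uniformDistribution (S : Type*) [Fintype S] : S → ℝ :=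
  fun _ => (Fintype.card S : ℝ)⁻¹

lemma uniformDistribution_pos {S : Type*} [Fintype S] (s : S) : 0 < uniformDistribution S s :=
  inv_pos.2 (Nat.cast_pos.2 (Fintype.card_pos_iff.2 ⟨s⟩))

lemma sum_uniformDistribution (S : Type*) [Fintype S] [Nonempty S] :
    ∑ s, uniformDistribution S s = 1 := by
  simp [uniformDistribution]

section Uniform

variable {V : Type*} [Fintype V] {X : V → Type*} [∀ v, Fintype (X v)] {G : Digraph V}

lemma jointOfTables_uniformDistribution [DecidableEq V] :
    jointOfTables (G := G) (fun v _ => uniformDistribution (X v)) =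
      uniformDistribution (∀ v, X v) := by
  funext x
  simp [jointOfTables, uniformDistribution]

variable [DecidableEq V] [∀ v, Nonempty (X v)]

lemma uniformDistribution_mem_bayesNetModel (hG : G.IsDAG) :
    uniformDistribution (∀ v, X v) ∈ bayesNetModel X G := by
  rw [← jointOfTables_uniformDistribution (G := G)]
  exact jointOfTables_mem_bayesNetModel hG (fun v _ => uniformDistribution_pos)
    fun v _ => sum_uniformDistribution (X v)

/-- The curve that reweights the table of `k` by `1 + ε f` stays in the model. -/
lemma jointOfTables_mul_mem_modelTangentCone (hG : G.IsDAG) {κ : ConditionalTables X G}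
    (hκ : ∀ v c a, 0 < κ v c a) (hsum : ∀ v c, ∑ a, κ v c a = 1) {k : V}
    {f : (∀ u : {u : V // G.Adj u k}, X u) → X k → ℝ} (hf : ∀ c, ∑ a, κ k c a * f c a = 0) :
    (fun x => jointOfTables κ x * f (parentConfig G k x) (x k)) ∈
      modelTangentCone (bayesNetModel X G) (jointOfTables κ) := by
  refine feasibleDirections_subset_modelTangentCone (mem_feasibleDirections.2 ?_)
  have hpos : ∀ᶠ ε in 𝓝[>] (0 : ℝ), ∀ c a, 0 < 1 + ε * f c a :=
    eventually_all.2 fun c => eventually_all.2 fun a => nhdsWithin_le_nhds <|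
      have hcont : Continuous fun ε : ℝ => 1 + ε * f c a := by fun_prop
      (hcont.tendsto' 0 1 (by simp)).eventually_const_lt one_pos
  filter_upwards [hpos] with ε hε
  set κ' : ConditionalTables X G := Function.update κ k fun c a => κ k c a * (1 + ε * f c a)
  have hcurve : jointOfTables κ + ε • (fun x => jointOfTables κ x * f (parentConfig G k x) (x k)) =
      jointOfTables κ' := by
    funext x
    simp only [κ', jointOfTables_update_mul, Pi.add_apply, Pi.smul_apply, smul_eq_mul]
    ring
  rw [hcurve]
  refine jointOfTables_mem_bayesNetModel hG (fun v c a => ?_) fun v c => ?_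
  · rcases eq_or_ne v k with rfl | hvk
    · simpa only [κ', Function.update_self] using mul_pos (hκ v c a) (hε c a)
    · simpa only [κ', Function.update_of_ne hvk] using hκ v c a
  · rcases eq_or_ne v k with rfl | hvk
    · simp only [κ', Function.update_self, mul_add, mul_one, Finset.sum_add_distrib, hsum,
        mul_left_comm _ ε, ← Finset.mul_sum, hf, mul_zero, add_zero]
    · simp only [κ', Function.update_of_ne hvk, hsum]

lemma comp_parentConfig_mul_mem_modelTangentCone (hG : G.IsDAG) {k : V}
    (φ : (∀ u : {u : V // G.Adj u k}, X u) → ℝ) {b : X k → ℝ} (hb : ∑ s, b s = 0) :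
    (fun x => φ (parentConfig G k x) * b (x k)) ∈
      modelTangentCone (bayesNetModel X G) (uniformDistribution (∀ v, X v)) := by
  have hmem := jointOfTables_mul_mem_modelTangentCone hG
    (κ := fun v _ => uniformDistribution (X v)) (fun v _ => uniformDistribution_pos)
    (fun v _ => sum_uniformDistribution (X v))
    (f := fun c s => Fintype.card (∀ v, X v) * (φ c * b s))
    fun c => by simp only [uniformDistribution, ← Finset.mul_sum, hb, mul_zero]
  rw [jointOfTables_uniformDistribution] at hmem
  convert hmem using 2 with x
  rw [uniformDistribution, inv_mul_cancel_left₀ (Nat.cast_ne_zero.2 Fintype.card_ne_zero)]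

lemma mul_mem_modelTangentCone_of_joined (hG : G.IsDAG) {i k : V} (hik : G.Joined i k)
    {a : X i → ℝ} {b : X k → ℝ} (ha : ∑ s, a s = 0) (hb : ∑ s, b s = 0) :
    (fun x => a (x i) * b (x k)) ∈
      modelTangentCone (bayesNetModel X G) (uniformDistribution (∀ v, X v)) := by
  rcases hik with hik | hki
  · exact comp_parentConfig_mul_mem_modelTangentCone hG (fun c => a (c ⟨i, hik⟩)) hb
  · simp only [mul_comm (a _)]
    exact comp_parentConfig_mul_mem_modelTangentCone hG (fun c => b (c ⟨k, hki⟩)) ha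

end Uniform

/-- The superposition of the interactions `a(x_i) b(x_k)` and `c(x_j) b(x_k)`, the direction in
which the model of a collider at `k` overlaps that of a noncollider. -/
def pairInteraction {V : Type*} {X : V → Type*} {i j k : V} (a : X i → ℝ) (c : X j → ℝ)
    (b : X k → ℝ) (x : ∀ v, X v) : ℝ :=
  (a (x i) + c (x j)) * b (x k)

lemma pairInteraction_comm {V : Type*} {X : V → Type*} {i j k : V} (a : X i → ℝ) (c : X j → ℝ)
    (b : X k → ℝ) : pairInteraction a c b = pairInteraction c a b := by
  funext x
  rw [pairInteraction, pairInteraction, add_comm]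

lemma pairInteraction_mem_modelTangentCone {V : Type*} [Fintype V] [DecidableEq V]
    {X : V → Type*} [∀ v, Fintype (X v)] [∀ v, Nonempty (X v)] {G : Digraph V} (hG : G.IsDAG)
    {i j k : V} (hik : G.Joined i k) (hjk : G.Joined j k) {a : X i → ℝ} {c : X j → ℝ}
    {b : X k → ℝ} (ha : ∑ s, a s = 0) (hc : ∑ s, c s = 0) (hb : ∑ s, b s = 0) :
    pairInteraction a c b ∈
      modelTangentCone (bayesNetModel X G) (uniformDistribution (∀ v, X v)) := by
  obtain ⟨L, hL⟩ := exists_submodule_modelTangentCone_eq hG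
    (uniformDistribution_mem_bayesNetModel (X := X) hG)
  have hiL := mul_mem_modelTangentCone_of_joined hG hik ha hb
  have hjL := mul_mem_modelTangentCone_of_joined hG hjk hc hb
  rw [hL] at hiL hjL ⊢
  have hadd : pairInteraction a c b =
      (fun x => a (x i) * b (x k)) + fun x => c (x j) * b (x k) :=
    funext fun x => add_mul _ _ _
  exact hadd ▸ L.add_mem hiL hjL

/-! ### Overlap at the uniform distribution -/

section Overlap

variable {V : Type*} [Fintype V] [DecidableEq V] {X : V → Type*} [∀ v, Fintype (X v)]
  [∀ v, Nonempty (X v)] {G : Digraph V}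

lemma tendsto_mul_parentCondMean {θ h : (∀ v, X v) → ℝ} (hθ : ∀ x, 0 < θ x) {v : V} {g : X v → ℝ}
    {c : ∀ u : {u : V // G.Adj u v}, X u} (hg : parentSum G v c (fun x => θ x * g (x v)) = 0)
    {α : ℕ → ℝ} {p : ℕ → (∀ v, X v) → ℝ} (hlim : Tendsto p atTop (𝓝 θ))
    (hder : Tendsto (fun n => α n • (p n - θ)) atTop (𝓝 h)) :
    Tendsto (fun n => α n * parentCondMean G (p n) v g c) atTop
      (𝓝 (parentSum G v c (fun x => h x * g (x v)) / parentSum G v c θ)) := by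
  have hden : Continuous fun q => parentSum G v c q := by
    unfold parentSum
    fun_prop
  have hnum : Continuous fun q : (∀ v, X v) → ℝ => parentSum G v c fun x => q x * g (x v) := by
    unfold parentSum
    fun_prop
  refine (((hnum.tendsto h).comp hder).div ((hden.tendsto θ).comp hlim)
    (parentSum_pos_of_pos hθ).ne').congr fun n => ?_
  have hcentre : parentSum G v c (fun x => (α n • (p n - θ)) x * g (x v)) =
      α n * (parentSum G v c (fun x => p n x * g (x v)) -
        parentSum G v c fun x => θ x * g (x v)) := by
    simp only [parentSum, ← Finset.sum_sub_distrib, Finset.mul_sum, Pi.smul_apply, Pi.sub_apply,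
      smul_eq_mul]
    exact Finset.sum_congr rfl fun x _ => by ring
  simp only [Pi.div_apply, Function.comp_apply, hcentre, hg, sub_zero, parentCondMean,
    mul_div_assoc]

/-- By the local Markov property `g(X_j)` can be replaced by its conditional mean given the parents
of `j`. That mean vanishes at `θ` to first order, and so does its product with `F`, which makes the
covariance of `F` and `g(X_j)` a quadratic function of the tangent vector `h`. -/
lemma tendsto_sq_mul_sum_mul_mul (hG : G.IsDAG) {θ h : (∀ v, X v) → ℝ} (hθ : ∀ x, 0 < θ x) {j : V}
    {F : (∀ v, X v) → ℝ} (hF : DependsOn F {u | Relation.ReflTransGen G.Adj j u}ᶜ) {g : X j → ℝ}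
    (hFθ : ∀ φ : (∀ u : {u : V // G.Adj u j}, X u) → ℝ,
      ∑ x, F x * (θ x * φ (parentConfig G j x)) = 0)
    (hg : ∀ c, parentSum G j c (fun x => θ x * g (x j)) = 0) {α : ℕ → ℝ}
    {p : ℕ → (∀ v, X v) → ℝ} (hp : ∀ n, p n ∈ bayesNetModel X G) (hlim : Tendsto p atTop (𝓝 θ))
    (hder : Tendsto (fun n => α n • (p n - θ)) atTop (𝓝 h)) :
    Tendsto (fun n => α n ^ 2 * ∑ x, F x * (p n x * g (x j))) atTop
      (𝓝 (∑ x, F x * (h x * (parentSum G j (parentConfig G j x) (fun y => h y * g (y j)) /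
        parentSum G j (parentConfig G j x) θ)))) := by
  refine (tendsto_finsetSum _ fun x _ => ((tendsto_pi_nhds.1 hder x).mul
    (tendsto_mul_parentCondMean hθ (hg (parentConfig G j x)) hlim hder)).const_mul (F x)).congr
    fun n => ?_
  calc ∑ x, F x * ((α n • (p n - θ)) x *
          (α n * parentCondMean G (p n) j g (parentConfig G j x)))
      = α n ^ 2 * (∑ x, F x * (p n x * parentCondMean G (p n) j g (parentConfig G j x)) -
          ∑ x, F x * (θ x * parentCondMean G (p n) j g (parentConfig G j x))) := by
        rw [← Finset.sum_sub_distrib, Finset.mul_sum]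
        refine Finset.sum_congr rfl fun x _ => ?_
        simp only [Pi.smul_apply, Pi.sub_apply, smul_eq_mul]
        ring
    _ = α n ^ 2 * ∑ x, F x * (p n x * g (x j)) := by
        rw [hFθ, sub_zero, sum_mul_mul_eq_sum_mul_parentCondMean hG (hp n) hF]

variable {i j k : V} {a : X i → ℝ} {c : X j → ℝ} {b : X k → ℝ} {α : ℕ → ℝ}
  {p : ℕ → (∀ v, X v) → ℝ} {h : (∀ v, X v) → ℝ}

lemma tendsto_sq_mul_covariance (hG : G.IsDAG) (hij : ¬ G.Adj i j)
    (hji : ¬ Relation.ReflTransGen G.Adj j i) (ha : ∑ s, a s = 0) (hc : ∑ s, c s = 0)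
    (hp : ∀ n, p n ∈ bayesNetModel X G)
    (hlim : Tendsto p atTop (𝓝 (uniformDistribution (∀ v, X v))))
    (hder : Tendsto (fun n => α n • (p n - uniformDistribution (∀ v, X v))) atTop (𝓝 h)) :
    Tendsto (fun n => α n ^ 2 * ∑ x, a (x i) * (p n x * c (x j))) atTop
      (𝓝 (∑ x, a (x i) * (h x * (parentSum G j (parentConfig G j x) (fun y => h y * c (y j)) /
        parentSum G j (parentConfig G j x) (uniformDistribution (∀ v, X v)))))) := by
  refine tendsto_sq_mul_sum_mul_mul hG uniformDistribution_pos (fun x y hxy => ?_) (fun φ => ?_)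
    (fun d => ?_) hp hlim hder
  · rw [hxy i hji]
  · simp only [mul_comm (a _)]
    refine sum_mul_apply_eq_zero (fun x y hxy => ?_) ha
    simp only [uniformDistribution, dependsOn_parentConfig G j fun u hu => hxy u <| by
      rintro rfl
      exact hij hu]
  · simp only [parentSum, ← mul_assoc]
    refine sum_mul_apply_eq_zero (fun x y hxy => ?_) hc
    simp only [uniformDistribution, dependsOn_parentConfig G j fun u hu => hxy u <| by
      rintro rfl
      exact hG u (.single hu)]

lemma parentSum_pairInteraction_mul_eq_zero (hik : i ≠ k) (hjk : j ≠ k) (hkj : ¬ G.Adj k j)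
    (hb : ∑ s, b s = 0) (d : ∀ u : {u : V // G.Adj u j}, X u) :
    parentSum G j d (fun x => pairInteraction a c b x * c (x j)) = 0 := by
  have hdep : DependsOn (fun x : ∀ v, X v =>
      (Set.indicator {d} 1 (parentConfig G j x) : ℝ) * ((a (x i) + c (x j)) * c (x j)))
      {k}ᶜ := fun x y hxy => by
    simp only [hxy i hik, hxy j hjk, dependsOn_parentConfig G j fun u hu => hxy u <| by
      rintro rfl
      exact hkj hu]
  rw [parentSum, ← sum_mul_apply_eq_zero hdep hb]
  exact Finset.sum_congr rfl fun x _ => by rw [pairInteraction]; ring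

lemma card_mul_parentSum_pairInteraction_mul (hG : G.IsDAG) (hij : i ≠ j) (hadj : ¬ G.Adj i j)
    (hkj : G.Adj k j) (ha : ∑ s, a s = 0) (x : ∀ v, X v) :
    Fintype.card (X j) *
        parentSum G j (parentConfig G j x) (fun y => pairInteraction a c b y * c (y j)) =
      b (x k) * ((∑ s, c s ^ 2) * parentSum G j (parentConfig G j x) 1) := by
  set w : (∀ v, X v) → ℝ := fun y => Set.indicator {parentConfig G j x} 1 (parentConfig G j y)
  have hw : DependsOn w {u | G.Adj u j} := fun y z hyz => by
    simp only [w, dependsOn_parentConfig G j hyz]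
  have hwb (y : ∀ v, X v) : w y * b (y k) = w y * b (x k) := by
    by_cases hy : parentConfig G j y = parentConfig G j x
    · rw [show y k = x k from congrFun hy ⟨k, hkj⟩]
    · simp [w, hy]
  have hcross : ∑ y, w y * c (y j) * a (y i) = 0 :=
    sum_mul_apply_eq_zero (fun y z hyz => by
      simp only [hyz j hij.symm, hw fun u hu => hyz u <| by
        rintro rfl
        exact hadj hu]) ha
  have hsquare : Fintype.card (X j) * ∑ y, w y * c (y j) ^ 2 = (∑ s, c s ^ 2) * ∑ y, w y :=
    card_mul_sum_mul_of_dependsOn (hw.mono fun u hu => by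
      rintro rfl
      exact hG u (.single hu)) fun y => by simp only [Function.update_self]
  calc (Fintype.card (X j) : ℝ) *
        parentSum G j (parentConfig G j x) (fun y => pairInteraction a c b y * c (y j))
      = Fintype.card (X j) *
          (b (x k) * (∑ y, w y * c (y j) * a (y i) + ∑ y, w y * c (y j) ^ 2)) := by
        rw [parentSum, ← Finset.sum_add_distrib, Finset.mul_sum (a := b (x k))]
        congr 1
        refine Finset.sum_congr rfl fun y _ => ?_
        rw [pairInteraction]
        linear_combination (a (y i) + c (y j)) * c (y j) * hwb y
    _ = b (x k) * ((∑ s, c s ^ 2) * parentSum G j (parentConfig G j x) 1) := by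
        simp only [hcross, zero_add, mul_left_comm _ (b (x k)), hsquare, parentSum, w,
          Pi.one_apply, mul_one]

lemma parentSum_pairInteraction_mul_div (hG : G.IsDAG) (hij : i ≠ j) (hadj : ¬ G.Adj i j)
    (hkj : G.Adj k j) (ha : ∑ s, a s = 0) (x : ∀ v, X v) :
    parentSum G j (parentConfig G j x) (fun y => pairInteraction a c b y * c (y j)) /
        parentSum G j (parentConfig G j x) (uniformDistribution (∀ v, X v)) =
      b (x k) * ((∑ s, c s ^ 2) / Fintype.card (X j) * Fintype.card (∀ v, X v)) := by
  have hmul := card_mul_parentSum_pairInteraction_mul (b := b) (c := c) hG hij hadj hkj ha x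
  have hX : (Fintype.card (X j) : ℝ) ≠ 0 := Nat.cast_ne_zero.2 Fintype.card_ne_zero
  have hS : (Fintype.card (∀ v, X v) : ℝ) ≠ 0 := Nat.cast_ne_zero.2 Fintype.card_ne_zero
  have hone : Fintype.card (∀ v, X v) • uniformDistribution (∀ v, X v) = 1 := funext fun y => by
    rw [Pi.smul_apply, nsmul_eq_mul, uniformDistribution, mul_inv_cancel₀ hS, Pi.one_apply]
  have hunif : parentSum G j (parentConfig G j x) 1 = Fintype.card (∀ v, X v) *
      parentSum G j (parentConfig G j x) (uniformDistribution (∀ v, X v)) := by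
    rw [← hone]
    simp only [parentSum, Finset.mul_sum, Pi.smul_apply, nsmul_eq_mul, mul_left_comm]
  rw [div_eq_iff (parentSum_pos_of_pos uniformDistribution_pos).ne']
  refine mul_left_cancel₀ hX ?_
  rw [hmul, hunif]
  field_simp

lemma tendsto_sq_mul_covariance_of_children (hG : G.IsDAG) (hij : ¬ G.Adj i j)
    (hji : ¬ Relation.ReflTransGen G.Adj j i) (hik : G.Adj i k) (hjk : G.Adj j k)
    (ha : ∑ s, a s = 0) (hc : ∑ s, c s = 0) (hb : ∑ s, b s = 0)
    (hp : ∀ n, p n ∈ bayesNetModel X G)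
    (hlim : Tendsto p atTop (𝓝 (uniformDistribution (∀ v, X v))))
    (hder : Tendsto (fun n => α n • (p n - uniformDistribution (∀ v, X v))) atTop
      (𝓝 (pairInteraction a c b))) :
    Tendsto (fun n => α n ^ 2 * ∑ x, a (x i) * (p n x * c (x j))) atTop (𝓝 0) := by
  have hik' : i ≠ k := by
    rintro rfl
    exact hG i (.single hik)
  have hjk' : j ≠ k := by
    rintro rfl
    exact hG j (.single hjk)
  have hkj : ¬ G.Adj k j := fun hkj => hG j (.tail (.single hjk) hkj)
  simpa only [parentSum_pairInteraction_mul_eq_zero hik' hjk' hkj hb, zero_div, mul_zero,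
    Finset.sum_const_zero] using tendsto_sq_mul_covariance hG hij hji ha hc hp hlim hder

lemma sum_mul_pairInteraction_mul_pos (hij : i ≠ j) (hik : i ≠ k) (hkj : k ≠ j)
    (hc : ∑ s, c s = 0) (ha0 : a ≠ 0) (hb0 : b ≠ 0) :
    0 < ∑ x, a (x i) * (pairInteraction a c b x * b (x k)) := by
  have hcross : ∑ x : ∀ v, X v, a (x i) * b (x k) ^ 2 * c (x j) = 0 :=
    sum_mul_apply_eq_zero (fun x y hxy => by simp only [hxy i hij, hxy k hkj]) hc
  have hsquare : ∑ x : ∀ v, X v, a (x i) * (pairInteraction a c b x * b (x k)) =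
      ∑ x : ∀ v, X v, (a (x i) * b (x k)) ^ 2 := by
    rw [← add_zero (∑ x, (_ : ℝ) ^ 2), ← hcross, ← Finset.sum_add_distrib]
    refine Finset.sum_congr rfl fun x _ => ?_
    rw [pairInteraction]
    ring
  obtain ⟨s, hs⟩ := Function.ne_iff.1 ha0
  obtain ⟨t, ht⟩ := Function.ne_iff.1 hb0
  rw [hsquare]
  refine Finset.sum_pos' (fun x _ => sq_nonneg _)
    ⟨Function.update (Function.update (fun _ => Classical.arbitrary _) k t) i s,
      Finset.mem_univ _, ?_⟩
  rw [Function.update_self, Function.update_of_ne hik.symm, Function.update_self]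
  exact sq_pos_of_ne_zero (mul_ne_zero hs ht)

lemma exists_tendsto_sq_mul_covariance_of_parent (hG : G.IsDAG) (hadj : ¬ G.Adj i j)
    (hji : ¬ Relation.ReflTransGen G.Adj j i) (hik : i ≠ k) (hkj : G.Adj k j)
    (ha : ∑ s, a s = 0) (hc : ∑ s, c s = 0) (ha0 : a ≠ 0) (hc0 : c ≠ 0) (hb0 : b ≠ 0)
    (hp : ∀ n, p n ∈ bayesNetModel X G)
    (hlim : Tendsto p atTop (𝓝 (uniformDistribution (∀ v, X v))))
    (hder : Tendsto (fun n => α n • (p n - uniformDistribution (∀ v, X v))) atTop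
      (𝓝 (pairInteraction a c b))) :
    ∃ r > 0, Tendsto (fun n => α n ^ 2 * ∑ x, a (x i) * (p n x * c (x j))) atTop (𝓝 r) := by
  have hij : i ≠ j := by
    rintro rfl
    exact hji .refl
  have hkj' : k ≠ j := by
    rintro rfl
    exact hG k (.single hkj)
  have hc2 : 0 < ∑ s, c s ^ 2 := by
    obtain ⟨s, hs⟩ := Function.ne_iff.1 hc0
    exact Finset.sum_pos' (fun _ _ => sq_nonneg _) ⟨s, Finset.mem_univ s, sq_pos_of_ne_zero hs⟩
  have hscale : 0 < (∑ s, c s ^ 2) / Fintype.card (X j) * Fintype.card (∀ v, X v) := by positivity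
  refine ⟨_, mul_pos (sum_mul_pairInteraction_mul_pos hij hik hkj' hc ha0 hb0) hscale, ?_⟩
  simpa only [parentSum_pairInteraction_mul_div hG hij hadj hkj ha, Finset.sum_mul, mul_assoc]
    using tendsto_sq_mul_covariance hG hadj hji ha hc hp hlim hder

lemma sum_mul_mul_left_comm {S R : Type*} [Fintype S] [CommSemiring R] (f p g : S → R) :
    ∑ x, f x * (p x * g x) = ∑ x, g x * (p x * f x) :=
  Finset.sum_congr rfl fun x _ => by ring

lemma tendsto_sq_mul_covariance_of_unshieldedCollider (hG : G.IsDAG)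
    (hcol : G.UnshieldedCollider i k j) (ha : ∑ s, a s = 0) (hc : ∑ s, c s = 0)
    (hb : ∑ s, b s = 0) (hp : ∀ n, p n ∈ bayesNetModel X G)
    (hlim : Tendsto p atTop (𝓝 (uniformDistribution (∀ v, X v))))
    (hder : Tendsto (fun n => α n • (p n - uniformDistribution (∀ v, X v))) atTop
      (𝓝 (pairInteraction a c b))) :
    Tendsto (fun n => α n ^ 2 * ∑ x, a (x i) * (p n x * c (x j))) atTop (𝓝 0) := by
  obtain ⟨hij, hjoin, hik, hjk⟩ := hcol
  rcases not_reflTransGen_or_of_isDAG hG hij with hji | hij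
  · exact tendsto_sq_mul_covariance_of_children hG (fun h => hjoin (.inl h)) hji hik hjk ha hc hb
      hp hlim hder
  · rw [pairInteraction_comm] at hder
    simp only [sum_mul_mul_left_comm fun x : ∀ v, X v => a (x i)]
    exact tendsto_sq_mul_covariance_of_children hG (fun h => hjoin (.inr h)) hij hjk hik hc ha hb
      hp hlim hder

lemma exists_tendsto_sq_mul_covariance_of_unshieldedNoncollider (hG : G.IsDAG)
    (hnon : G.UnshieldedNoncollider i k j) (ha : ∑ s, a s = 0) (hc : ∑ s, c s = 0) (ha0 : a ≠ 0)
    (hc0 : c ≠ 0) (hb0 : b ≠ 0) (hp : ∀ n, p n ∈ bayesNetModel X G)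
    (hlim : Tendsto p atTop (𝓝 (uniformDistribution (∀ v, X v))))
    (hder : Tendsto (fun n => α n • (p n - uniformDistribution (∀ v, X v))) atTop
      (𝓝 (pairInteraction a c b))) :
    ∃ r > 0, Tendsto (fun n => α n ^ 2 * ∑ x, a (x i) * (p n x * c (x j))) atTop (𝓝 r) := by
  obtain ⟨hij, hjoin, hik, hjk, hncol⟩ := hnon
  have hne {u v : V} (huv : G.Joined u v) : u ≠ v := by
    rintro rfl
    exact huv.elim (fun h => hG u (.single h)) fun h => hG u (.single h)
  rcases not_reflTransGen_or_of_isDAG hG hij with hji | hij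
  · have hkj : G.Adj k j := hjk.resolve_left fun hjk =>
      hik.elim (fun hik => hncol ⟨hik, hjk⟩) fun hki => hji (.tail (.single hjk) hki)
    exact exists_tendsto_sq_mul_covariance_of_parent hG (fun h => hjoin (.inl h)) hji (hne hik)
      hkj ha hc ha0 hc0 hb0 hp hlim hder
  · have hki : G.Adj k i := hik.resolve_left fun hik =>
      hjk.elim (fun hjk => hncol ⟨hik, hjk⟩) fun hkj => hij (.tail (.single hik) hkj)
    rw [pairInteraction_comm] at hder
    simp only [sum_mul_mul_left_comm fun x : ∀ v, X v => a (x i)]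
    exact exists_tendsto_sq_mul_covariance_of_parent hG (fun h => hjoin (.inr h)) hij (hne hjk)
      hki hc ha hc0 ha0 hb0 hp hlim hder

end Overlap

lemma exists_sum_eq_zero_and_ne_zero (S : Type*) [Fintype S] [Nontrivial S] :
    ∃ a : S → ℝ, ∑ s, a s = 0 ∧ a ≠ 0 := by
  classical
  obtain ⟨s, t, hst⟩ := exists_pair_ne S
  refine ⟨Pi.single s 1 - Pi.single t 1, by simp, fun h => ?_⟩
  simpa [hst] using congrFun h s

lemma overlapAt_uniformDistribution {V : Type*} [Fintype V] [DecidableEq V] {X : V → Type*}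
    [∀ v, Fintype (X v)] [∀ v, Nonempty (X v)] {G₁ G₂ : Digraph V} {i j k : V} [Nontrivial (X i)]
    [Nontrivial (X j)] [Nontrivial (X k)] (hG₁ : G₁.IsDAG) (hG₂ : G₂.IsDAG)
    (hcol : G₁.UnshieldedCollider i k j) (hnon : G₂.UnshieldedNoncollider i k j) :
    OverlapAt (bayesNetModel X G₁) (bayesNetModel X G₂) (uniformDistribution (∀ v, X v)) := by
  obtain ⟨a, ha, ha0⟩ := exists_sum_eq_zero_and_ne_zero (X i)
  obtain ⟨c, hc, hc0⟩ := exists_sum_eq_zero_and_ne_zero (X j)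
  obtain ⟨b, hb, hb0⟩ := exists_sum_eq_zero_and_ne_zero (X k)
  have ⟨_, _, hik₁, hjk₁⟩ := hcol
  have ⟨_, _, hik₂, hjk₂, _⟩ := hnon
  refine ⟨⟨uniformDistribution_mem_bayesNetModel hG₁, uniformDistribution_mem_bayesNetModel hG₂⟩,
    pairInteraction a c b, ⟨?_, ?_⟩, ?_⟩
  · exact pairInteraction_mem_modelTangentCone hG₁ (.inl hik₁) (.inl hjk₁) ha hc hb
  · exact pairInteraction_mem_modelTangentCone hG₂ hik₂ hjk₂ ha hc hb
  · rintro ⟨α, p, -, hp, hlim, hder⟩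
    have hzero := tendsto_sq_mul_covariance_of_unshieldedCollider hG₁ hcol ha hc hb
      (fun n => (hp n).1) hlim hder
    obtain ⟨r, hr, hpos⟩ := exists_tendsto_sq_mul_covariance_of_unshieldedNoncollider hG₂ hnon
      ha hc ha0 hc0 hb0 (fun n => (hp n).2) hlim hder
    exact hr.ne' (tendsto_nhds_unique hpos hzero)

/-! ### Overlap excludes simultaneous convexity -/

section Parameterization

variable {S : Type*} [Fintype S]

lemma mem_range_of_sum_eq_zero [Nonempty S] {E : Type*} [AddCommGroup E] [Module ℝ E]
    (hE : Module.finrank ℝ E = Fintype.card S - 1) {f : E →ₗ[ℝ] S → ℝ} (hf : Function.Injective f)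
    (hsum : ∀ z, ∑ s, f z s = 0) {y : S → ℝ} (hy : ∑ s, y s = 0) : y ∈ f.range := by
  classical
  set σ : (S → ℝ) →ₗ[ℝ] ℝ := ∑ s, LinearMap.proj s
  have hσ (z : S → ℝ) : σ z = ∑ s, z s := by simp [σ]
  have hle : f.range ≤ σ.ker := by
    rintro _ ⟨z, rfl⟩
    rw [LinearMap.mem_ker, hσ, hsum]
  have hsurj : σ.range = ⊤ := LinearMap.range_eq_top.2 fun r =>
    ⟨Pi.single (Classical.arbitrary S) r, by simp [hσ]⟩
  have hker := σ.finrank_range_add_finrank_ker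
  rw [hsurj, finrank_top, Module.finrank_self, Module.finrank_fintype_fun_eq_card] at hker
  have hrange : f.range = σ.ker := Submodule.eq_of_le_of_finrank_eq hle <| by
    rw [LinearMap.finrank_range_of_inj hf]
    omega
  rw [hrange, LinearMap.mem_ker, hσ, hy]

lemma IsParameterization.hasStrictFDerivAt {E F : Type*} [NormedAddCommGroup E] [NormedSpace ℝ E]
    [NormedAddCommGroup F] [NormedSpace ℝ F] {ψ : E → F} {Θ : Set E} {D : Set F}
    (hψ : IsParameterization ψ Θ D) {η : E} (hη : η ∈ Θ) :
    HasStrictFDerivAt ψ (fderiv ℝ ψ η) η := by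
  have hΘ : Θ ∈ 𝓝 η := hψ.isOpen.mem_nhds hη
  refine hasStrictFDerivAt_of_hasFDerivAt_of_continuousAt (eventually_of_mem hΘ fun s hs => ?_)
    (hψ.twice_differentiableOn.differentiableAt hΘ).continuousAt
  exact (hψ.differentiableOn.differentiableAt (hψ.isOpen.mem_nhds hs)).hasFDerivAt

variable {E : Type*} [NormedAddCommGroup E] [NormedSpace ℝ E] {ψ : E → S → ℝ} {η : E}

lemma sum_fderiv_apply_eq_zero {r : ℝ} (hψ : DifferentiableAt ℝ ψ η)
    (hsum : ∀ᶠ t in 𝓝 η, ∑ s, ψ t s = r) (z : E) : ∑ s, fderiv ℝ ψ η z s = 0 := by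
  have hderiv : HasFDerivAt (fun t => ∑ s, ψ t s)
      (∑ s, (ContinuousLinearMap.proj s).comp (fderiv ℝ ψ η)) η :=
    HasFDerivAt.fun_sum fun s _ => hasFDerivAt_pi'.1 hψ.hasFDerivAt s
  have hconst : HasFDerivAt (fun t => ∑ s, ψ t s) (0 : E →L[ℝ] ℝ) η :=
    (hasFDerivAt_const r η).congr_of_eventuallyEq hsum
  simpa using DFunLike.congr_fun (hderiv.unique hconst) z

lemma IsParameterization.eventually_sub_mem_range [Nonempty S]
    (hE : Module.finrank ℝ E = Fintype.card S - 1) {Θ : Set E} {W : Set (S → ℝ)}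
    (hψ : IsParameterization ψ Θ (W ∩ openSimplex S)) (hη : η ∈ Θ) :
    ∀ᶠ s in 𝓝 η, ∀ t ∈ openSimplex S, ψ s - t ∈ Set.range (fderiv ℝ ψ η) := by
  have hsum : ∀ᶠ s in 𝓝 η, ∑ x, ψ s x = 1 :=
    eventually_of_mem (hψ.isOpen.mem_nhds hη) fun s hs => (hψ.bijOn.mapsTo hs).2.2
  have hsum0 := sum_fderiv_apply_eq_zero
    (hψ.differentiableOn.differentiableAt (hψ.isOpen.mem_nhds hη)) hsum
  filter_upwards [hsum] with s hs t ht
  refine mem_range_of_sum_eq_zero hE (f := (fderiv ℝ ψ η : E →ₗ[ℝ] S → ℝ)) (hψ.full_rank η hη)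
    hsum0 ?_
  simp only [Pi.sub_apply, Finset.sum_sub_distrib, hs, ht.2, sub_self]

lemma OverlapAt.not_simultaneouslyConvexNear [Nonempty S] {𝓜 : Set (Set (S → ℝ))}
    {M₁ M₂ : Set (S → ℝ)} {θ : S → ℝ} (hov : OverlapAt M₁ M₂ θ) (hM₁ : M₁ ∈ 𝓜) (hM₂ : M₂ ∈ 𝓜)
    (hS₁ : M₁ ⊆ openSimplex S) (hS₂ : M₂ ⊆ openSimplex S) {L₁ L₂ : Submodule ℝ (S → ℝ)}
    (hL₁ : modelTangentCone M₁ θ = L₁) (hL₂ : modelTangentCone M₂ θ = L₂) :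
    ¬ SimultaneouslyConvexNear 𝓜 θ := by
  rintro ⟨W, Θ, ψ, -, hψ, η, hη, rfl, hconv⟩
  have hΘ : Θ ∈ 𝓝 η := hψ.isOpen.mem_nhds hη
  have hderiv := hψ.hasStrictFDerivAt hη
  have hinv : (fderiv ℝ ψ η).HasLeftInverse :=
    .of_injective_of_finiteDimensional (hψ.full_rank η hη)
  have hrange {M : Set (S → ℝ)} (hS : M ⊆ openSimplex S) :
      ∀ᶠ s in 𝓝 η, ∀ t ∈ M, ψ s - t ∈ Set.range (fderiv ℝ ψ η) :=
    (hψ.eventually_sub_mem_range finrank_euclideanSpace_fin hη).mono fun s hs t ht => hs t (hS ht)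
  have hcone {M : Set (S → ℝ)} (hS : M ⊆ openSimplex S) {L : Submodule ℝ (S → ℝ)}
      (hL : modelTangentCone M (ψ η) = L) :
      modelTangentCone (Θ ∩ ψ ⁻¹' M) η =
        (L.comap (fderiv ℝ ψ η).toLinearMap : Submodule ℝ _) := by
    rw [modelTangentCone_preimage hderiv hinv hΘ (hrange hS), hL]
    rfl
  exact not_overlapAt_of_convexNear (hconv M₁ hM₁) (hconv M₂ hM₂) (hcone hS₁ hL₁) (hcone hS₂ hL₂)
    (hov.preimage hderiv hinv hΘ (hrange hS₁) (hrange hS₂))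

end Parameterization

/-! ### Bayesian networks are not simultaneously convex -/

lemma isDAG_of_rank {V : Type*} {G : Digraph V} (r : V → ℕ)
    (hr : ∀ u v, G.Adj u v → r u < r v) : G.IsDAG := fun v hv => by
  have hlt : Relation.TransGen (· < ·) (r v) (r v) := hv.lift r hr
  rw [Relation.transGen_eq_self] at hlt
  exact hlt.false

lemma exists_unshieldedCollider_and_unshieldedNoncollider {V : Type*} {i j k : V} (hij : i ≠ j)
    (hik : i ≠ k) (hjk : j ≠ k) :
    ∃ G₁ G₂ : Digraph V, G₁.IsDAG ∧ G₂.IsDAG ∧ G₁.UnshieldedCollider i k j ∧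
      G₂.UnshieldedNoncollider i k j := by
  classical
  refine ⟨⟨fun u v => (u = i ∨ u = j) ∧ v = k⟩, ⟨fun u v => u = k ∧ (v = i ∨ v = j)⟩,
    isDAG_of_rank (fun v => if v = k then 1 else 0) ?_,
    isDAG_of_rank (fun v => if v = k then 0 else 1) ?_, ?_, ?_⟩
  · rintro u v ⟨rfl | rfl, rfl⟩ <;> simp [*]
  · rintro u v ⟨rfl, rfl | rfl⟩ <;> simp [*]
  · simp [Digraph.UnshieldedCollider, Digraph.Joined, *]
  · simp [Digraph.UnshieldedNoncollider, Digraph.Joined, *]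

lemma not_simultaneouslyConvexNear_uniformDistribution {V : Type*} [Fintype V] [DecidableEq V]
    {X : V → Type*} [∀ v, Fintype (X v)] [∀ v, Nonempty (X v)] {G₁ G₂ : Digraph V} {i j k : V}
    [Nontrivial (X i)] [Nontrivial (X j)] [Nontrivial (X k)] (hG₁ : G₁.IsDAG) (hG₂ : G₂.IsDAG)
    (hcol : G₁.UnshieldedCollider i k j) (hnon : G₂.UnshieldedNoncollider i k j)
    {𝓜 : Set (Set ((∀ v, X v) → ℝ))} (hM₁ : bayesNetModel X G₁ ∈ 𝓜)
    (hM₂ : bayesNetModel X G₂ ∈ 𝓜) :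
    ¬ SimultaneouslyConvexNear 𝓜 (uniformDistribution (∀ v, X v)) := by
  obtain ⟨L₁, hL₁⟩ := exists_submodule_modelTangentCone_eq hG₁
    (uniformDistribution_mem_bayesNetModel (X := X) hG₁)
  obtain ⟨L₂, hL₂⟩ := exists_submodule_modelTangentCone_eq hG₂
    (uniformDistribution_mem_bayesNetModel (X := X) hG₂)
  exact (overlapAt_uniformDistribution hG₁ hG₂ hcol hnon).not_simultaneouslyConvexNear hM₁ hM₂
    (fun _ hp => hp.1) (fun _ hp => hp.1) hL₁ hL₂

theorem mainTheorem9_general {V : Type*} [Fintype V] [DecidableEq V] (X : V → Type*)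
    [∀ v, Fintype (X v)] [∀ v, Nonempty (X v)] :
    (∀ (G₁ G₂ : Digraph V) (i j k : V), G₁.IsDAG → G₂.IsDAG →
      G₁.UnshieldedCollider i k j → G₂.UnshieldedNoncollider i k j →
      Nontrivial (X i) → Nontrivial (X j) → Nontrivial (X k) →
      ∃ θ, OverlapAt (bayesNetModel X G₁) (bayesNetModel X G₂) θ ∧
        ¬ SimultaneouslyConvexNear {bayesNetModel X G₁, bayesNetModel X G₂} θ) ∧
    (3 ≤ {v | Nontrivial (X v)}.ncard →
      ∃ θ, (∀ M ∈ bayesNetModels X, θ ∈ M) ∧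
        ¬ SimultaneouslyConvexNear (bayesNetModels X) θ) := by
  refine ⟨fun G₁ G₂ i j k hG₁ hG₂ hcol hnon _ _ _ => ⟨_,
    overlapAt_uniformDistribution hG₁ hG₂ hcol hnon,
    not_simultaneouslyConvexNear_uniformDistribution hG₁ hG₂ hcol hnon (.inl rfl) (.inr rfl)⟩,
    fun hV => ⟨uniformDistribution (∀ v, X v), ?_, ?_⟩⟩
  · rintro M ⟨G, hG, rfl⟩
    exact uniformDistribution_mem_bayesNetModel hG
  · obtain ⟨i, j, k, hi, hj, hk, hij, hik, hjk⟩ := (Set.two_lt_ncard_iff (Set.toFinite _)).1 hV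
    have : Nontrivial (X i) := hi
    have : Nontrivial (X j) := hj
    have : Nontrivial (X k) := hk
    obtain ⟨G₁, G₂, hG₁, hG₂, hcol, hnon⟩ :=
      exists_unshieldedCollider_and_unshieldedNoncollider hij hik hjk
    exact not_simultaneouslyConvexNear_uniformDistribution hG₁ hG₂ hcol hnon
      ⟨G₁, hG₁, rfl⟩ ⟨G₂, hG₂, rfl⟩

theorem mainTheorem9 {V : Type*} [Fintype V] [DecidableEq V] (X : V → Type*)
    [∀ v, Fintype (X v)] [∀ v, Nontrivial (X v)] :
    (∀ (G₁ G₂ : Digraph V) (i j k : V), G₁.IsDAG → G₂.IsDAG →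
      G₁.UnshieldedCollider i k j → G₂.UnshieldedNoncollider i k j → Fintype.card (X k) = 2 →
      ∃ θ, OverlapAt (bayesNetModel X G₁) (bayesNetModel X G₂) θ ∧
        ¬ SimultaneouslyConvexNear {bayesNetModel X G₁, bayesNetModel X G₂} θ) ∧
    (3 ≤ Fintype.card V → (∃ k, Fintype.card (X k) = 2) →
      ∃ θ, (∀ M ∈ bayesNetModels X, θ ∈ M) ∧
        ¬ SimultaneouslyConvexNear (bayesNetModels X) θ) := by
  have ⟨hpair, hclass⟩ := mainTheorem9_general X
  exact ⟨fun G₁ G₂ i j k hG₁ hG₂ hcol hnon _ =>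
    hpair G₁ G₂ i j k hG₁ hG₂ hcol hnon inferInstance inferInstance inferInstance,
    fun hV _ => hclass (by simpa [‹∀ v, Nontrivial (X v)›, Set.ncard_univ] using hV)⟩
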